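/- Let $\sigma:\mathbb{R}\to\mathbb{R}$ satisfy the following assumption: there is a constant $c_\sigma\ge 1$, depending only on $\sigma$, such that for all $L\ge 0$, $R>0$, $\delta>0$ and every $L$-Lipschitz function $f:\mathbb{R}\to\mathbb{R}$ which is constant outside the interval $[-R,R]$, there exist a natural number $w\le c_\sigma\frac{RL}{\delta}$ and real numbers $a,\alpha_i,\beta_i,\gamma_i$ ($1\le i\le w$) such that \[ \sup_{x\in\mathbb{R}}\Bigl|f(x)-\Bigl(a+\sum_{i=1}^{w}\alpha_i\,\sigma(\beta_i x-\gamma_i)\Bigr)\Bigr|\le\delta . \] Then there is a constant $C>0$, depending only on $\sigma$, such that for every dimension $d\ge 1$, every natural number $k\ge 1$ and every $\epsilon>0$ there is a depth-$2$ neural network on $\mathbb{R}^d$ with activation $\sigma$ and width \[ n\le \exp\bigl(C\,k^2\log(d/\epsilon)\bigr) = (d/\epsilon)^{Ck^2} \] (for fixed $k$, polynomial in both $d$ and $1/\epsilon$), that is, there are $\mathbf{w}_i\in\mathbb{R}^d$, $v_i,b_i\in\mathbb{R}$ ($1\le i\le n$) and $b_0\in\mathbb{R}$, such that \[ \sup_{\mathbf{x}\in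 B_d}\Bigl|\sum_{i=1}^{n}v_i\,\sigma\bigl(\mathbf{w}_i^{\top}\mathbf{x}+b_i\bigr)+b_0-\|\mathbf{x}\|^{2k}\Bigr|\le\epsilon , \] where $\|\cdot\|$ is the Euclidean norm and $B_d=\{\mathbf{x}\in\mathbb{R}^d:\|\mathbf{x}\|\le 1\}$. -/

import Mathlib

/-- The standing assumption on an activation function `σ : ℝ → ℝ`: there is a constant
`c ≥ 1`, depending only on `σ`, such that every `L`-Lipschitz function `f : ℝ → ℝ` which is
constant outside `[-R, R]` is uniformly `δ`-close on `ℝ` to a univariate `σ`-network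
`x ↦ a + ∑ αᵢ σ (βᵢ x - γᵢ)` with at most `c R L / δ` neurons. -/
def ActivationAssumption (σ : ℝ → ℝ) : Prop :=
  ∃ c : ℝ, 1 ≤ c ∧
    ∀ (L : NNReal) (R δ : ℝ) (f : ℝ → ℝ), 0 < R → 0 < δ → LipschitzWith L f →
      (∃ y : ℝ, ∀ x : ℝ, x ∉ Set.Icc (-R) R → f x = y) →
      ∃ (w : ℕ) (a : ℝ) (α β γ : Fin w → ℝ),
        (w : ℝ) ≤ c * (R * (L : ℝ) / δ) ∧
        ∀ x : ℝ, |f x - (a + ∑ i, α i * σ (β i * x - γ i))| ≤ δ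

/-- The function `x ↦ ∑ vᵢ σ (⟨wᵢ, x⟩ + bᵢ) + b₀` computed by a depth-2 network on `ℝ^d` of
width `n` with activation `σ`. -/
noncomputable def depthTwoNetwork (σ : ℝ → ℝ) {d n : ℕ}
    (w : Fin n → EuclideanSpace ℝ (Fin d)) (v b : Fin n → ℝ) (b₀ : ℝ)
    (x : EuclideanSpace ℝ (Fin d)) : ℝ :=
  ∑ i, v i * σ (inner ℝ (w i) x + b i) + b₀

/-! Expanding `‖x‖ ^ (2k) = (∑ x_i ^ 2) ^ k` gives `d ^ k` monomials of degree `2k`, and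
polarization writes each as a signed combination of `4 ^ k` powers `ℓ(x) ^ (2k)` of sums of
coordinates. So `(4d) ^ k` ridge functions share the single profile `t ^ (2k)`. On the unit ball
`|ℓ(x)| ≤ 2k`, so truncating the profile there makes it Lipschitz and constant far out; one
univariate approximation to accuracy `ε / (4d) ^ k` serves every direction. -/

open Finset in
/-- The polarization identity, over subsets of the index set. -/
theorem sum_neg_one_pow_card_mul_sum_compl_pow {J : Type*} [Fintype J] [DecidableEq J]
    (y : J → ℝ) :
    ∑ S : Finset J, (-1 : ℝ) ^ #S * (∑ j ∈ Sᶜ, y j) ^ Fintype.card J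
      = (Fintype.card J).factorial * ∏ j, y j := by
  have expand (S : Finset J) : (∑ j ∈ Sᶜ, y j) ^ Fintype.card J
      = ∑ q : J → J, if S ⊆ (univ.image q)ᶜ then ∏ j, y (q j) else 0 := by
    have h1 : ∑ j ∈ Sᶜ, y j = ∑ j, if j ∈ S then 0 else y j := by
      rw [← sum_filter_add_sum_filter_not univ (fun j => j ∈ S)]
      rw [sum_eq_zero (s := univ.filter (· ∈ S)) (by simp +contextual), zero_add]
      refine sum_congr (by ext; simp) (by simp +contextual)
    have h2 := prod_univ_sum (fun _ : J => (univ : Finset J))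
      (fun _ j => if j ∈ S then 0 else y j)
    rw [prod_const, card_univ, Fintype.piFinset_univ] at h2
    rw [h1, h2]
    refine sum_congr rfl fun q _ => ?_
    split_ifs with h
    · refine prod_congr rfl fun j _ => if_neg fun hj => ?_
      simpa using h hj
    · obtain ⟨a, haS, ha⟩ := not_subset.1 h
      obtain ⟨j, rfl⟩ : ∃ j, q j = a := by simpa using ha
      exact prod_eq_zero (mem_univ j) (if_pos haS)
  -- The alternating sum over subsets of the complement of the image of `q` vanishes unless that
  -- complement is empty, so only permutations survive.
  have inner_sum (q : J → J) :
      ∑ S : Finset J, (-1 : ℝ) ^ #S * (if S ⊆ (univ.image q)ᶜ then ∏ j, y (q j) else 0)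
        = if Function.Bijective q then ∏ j, y j else 0 := by
    have h1 : ∑ S : Finset J, (-1 : ℝ) ^ #S * (if S ⊆ (univ.image q)ᶜ then ∏ j, y (q j) else 0)
        = (∑ S ∈ ((univ.image q)ᶜ).powerset, (-1 : ℝ) ^ #S) * ∏ j, y (q j) := by
      simp only [mul_ite, mul_zero, sum_mul]
      rw [← sum_filter]
      exact sum_congr (by ext; simp) fun _ _ => rfl
    have h2 := congrArg (Int.cast : ℤ → ℝ) (sum_powerset_neg_one_pow_card (x := (univ.image q)ᶜ))
    push_cast at h2
    rw [h1, h2]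
    by_cases hq : Function.Bijective q
    · have : (univ.image q)ᶜ = ∅ := by
        rw [image_univ_of_surjective hq.2, compl_univ]
      rw [if_pos this, if_pos hq, one_mul]
      exact hq.prod_comp y
    · have : (univ.image q)ᶜ ≠ ∅ := fun h => hq <| Finite.surjective_iff_bijective.1 fun a => by
        have : a ∈ univ.image q := by rw [(compl_eq_empty_iff _).1 h]; exact mem_univ a
        simpa using this
      rw [if_neg this, if_neg hq, zero_mul]
  simp_rw [expand, mul_sum]
  rw [sum_comm]
  simp_rw [inner_sum]
  rw [← sum_filter, sum_const, nsmul_eq_mul]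
  congr 2
  rw [← Fintype.card_perm, ← Fintype.card_subtype]
  exact Fintype.card_congr (Equiv.ofBijective (fun e : Equiv.Perm J => ⟨e, e.bijective⟩)
    ⟨fun e f h => Equiv.ext (congrFun (congrArg Subtype.val h)),
      fun q => ⟨Equiv.ofBijective q.1 q.2, rfl⟩⟩).symm

open Finset in
/-- The power `‖x‖ ^ (2k)` as a signed sum of `2k`-th powers of linear forms. -/
theorem norm_pow_two_mul_eq_sum_polarization {d : ℕ} (k : ℕ) (x : EuclideanSpace ℝ (Fin d)) :
    ‖x‖ ^ (2 * k) = ∑ u : (Fin k → Fin d) × Finset (Fin k × Bool),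
      ((-1) ^ #u.2 / (2 * k).factorial) * (∑ j ∈ u.2ᶜ, x (u.1 j.1)) ^ (2 * k) := by
  have hcard : Fintype.card (Fin k × Bool) = 2 * k := by simp [mul_comm]
  -- The `Bool` factor repeats each coordinate, encoding its square.
  have hnorm : ‖x‖ ^ (2 * k) = ∑ p : Fin k → Fin d, ∏ j : Fin k × Bool, x (p j.1) := by
    have h := prod_univ_sum (fun _ : Fin k => (univ : Finset (Fin d))) (fun _ i => x i ^ 2)
    rw [prod_const, card_univ, Fintype.piFinset_univ, Fintype.card_fin] at h
    rw [pow_mul, EuclideanSpace.real_norm_sq_eq, h]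
    refine sum_congr rfl fun p _ => ?_
    rw [Fintype.prod_prod_type]
    simp [sq]
  rw [hnorm, Fintype.sum_prod_type]
  refine sum_congr rfl fun p _ => ?_
  have h := sum_neg_one_pow_card_mul_sum_compl_pow (fun j : Fin k × Bool => x (p j.1))
  rw [hcard] at h
  have h0 : ((2 * k).factorial : ℝ) ≠ 0 := by positivity
  rw [eq_comm, ← mul_right_inj' h0, ← h, mul_sum]
  exact sum_congr rfl fun S _ => by field_simp

/-- The power function truncated at `|t| = R` is Lipschitz. -/
theorem lipschitzWith_min_abs_pow (R : NNReal) (m : ℕ) :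
    LipschitzWith (m * R ^ (m - 1)) fun t : ℝ => min |t| (R : ℝ) ^ m := by
  refine LipschitzWith.of_dist_le_mul fun s t => ?_
  have hs : 0 ≤ min |s| (R : ℝ) := le_min (abs_nonneg _) R.2
  have ht : 0 ≤ min |t| (R : ℝ) := le_min (abs_nonneg _) R.2
  have h1 : |min |s| (R : ℝ) - min |t| R| ≤ |s - t| := by
    refine (abs_min_sub_min_le_max _ _ _ _).trans ?_
    simpa using abs_abs_sub_abs_le s t
  rw [Real.dist_eq, Real.dist_eq]
  refine (abs_pow_sub_pow_le _ _ m).trans ?_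
  rw [abs_of_nonneg hs, abs_of_nonneg ht]
  push_cast
  have h2 : max (min |s| (R : ℝ)) (min |t| R) ≤ R := max_le (min_le_right _ _) (min_le_right _ _)
  calc _ ≤ |s - t| * m * (R : ℝ) ^ (m - 1) := by
        gcongr
    _ = _ := by ring

/-- A signed combination of ridge functions with a common approximable profile is approximated by
a depth-2 network. -/
theorem exists_depthTwoNetwork_of_sum_ridge {σ : ℝ → ℝ} {d w : ℕ} {U : Type*} [Fintype U]
    (a : ℝ) (α β γ : Fin w → ℝ) (c : U → ℝ) (W : U → EuclideanSpace ℝ (Fin d)) :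
    ∃ (W' : Fin (Fintype.card U * w) → EuclideanSpace ℝ (Fin d))
      (v b : Fin (Fintype.card U * w) → ℝ) (b₀ : ℝ), ∀ x,
        depthTwoNetwork σ W' v b b₀ x
          = ∑ u, c u * (a + ∑ i, α i * σ (β i * inner ℝ (W u) x - γ i)) := by
  have e : Fin (Fintype.card U * w) ≃ U × Fin w :=
    (finProdFinEquiv.symm).trans ((Fintype.equivFin U).symm.prodCongr (Equiv.refl _))
  refine ⟨fun i => β (e i).2 • W (e i).1, fun i => c (e i).1 * α (e i).2, fun i => -γ (e i).2,
    ∑ u, c u * a, fun x => ?_⟩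
  rw [depthTwoNetwork, e.sum_comp (fun q : U × Fin w =>
    c q.1 * α q.2 * σ (inner ℝ (β q.2 • W q.1) x + -γ q.2)), Fintype.sum_prod_type,
    ← Finset.sum_add_distrib]
  refine Finset.sum_congr rfl fun u _ => ?_
  rw [mul_add, Finset.mul_sum, add_comm]
  simp only [real_inner_smul_left, mul_assoc, sub_eq_add_neg]

/-- The width of the network is at most a power of `d / ε` with exponent `O(k ^ 2)`. -/
theorem width_bound {c D ε : ℝ} {k : ℕ} (hD : 1 ≤ D) (hk : 1 ≤ k) (hε : 0 < ε)
    (hε' : ε < 1 / 2) :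
    (4 * D) ^ k * (c * (2 * k * (2 * k * (2 * k) ^ (2 * k - 1)) / (ε / (4 * D) ^ k)))
      ≤ Real.exp ((⌈c⌉₊ + 13) * ((k : ℝ) ^ 2 * Real.log (D / ε))) := by
  set X : ℝ := D / ε with hX
  have hDX : D = X * ε := by rw [hX]; field_simp
  -- A base of at least 2 lets powers of `X` absorb all constants, including `c`.
  have hX2 : 2 ≤ X := by rw [hX, le_div_iff₀ hε]; linarith
  have hX1 : 1 ≤ X := by linarith
  have hX0 : 0 < X := by linarith
  have two_pow_le (n : ℕ) : (n : ℝ) ≤ X ^ n :=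
    calc (n : ℝ) ≤ 2 ^ n := by exact_mod_cast Nat.lt_two_pow_self.le
      _ ≤ X ^ n := by gcongr
  have h1 : c ≤ X ^ ⌈c⌉₊ := (Nat.le_ceil c).trans (two_pow_le _)
  have h2 : 4 * D ≤ X ^ 3 := by nlinarith [mul_le_mul hX2 hX2 (by norm_num) hX0.le]
  have h3 : (2 * k : ℝ) ≤ X ^ (2 * k) := by exact_mod_cast two_pow_le (2 * k)
  have h4 : 1 / ε ≤ X := by rw [hX]; gcongr
  have hpow : (2 * k : ℝ) * (2 * k) ^ (2 * k - 1) = (2 * k) ^ (2 * k) := by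
    rw [← pow_succ', Nat.sub_add_cancel (by omega)]
  have hexp : Real.exp ((⌈c⌉₊ + 13) * ((k : ℝ) ^ 2 * Real.log X)) = X ^ ((⌈c⌉₊ + 13) * k ^ 2) := by
    rw [← Real.exp_log (pow_pos hX0 _), Real.log_pow]
    push_cast
    ring_nf
  rw [hexp, hpow]
  calc _ = c * ((4 * D) ^ k * (4 * D) ^ k * ((2 * k) * (2 * k) ^ (2 * k)) * (1 / ε)) := by
        field_simp
    _ ≤ X ^ ⌈c⌉₊ * ((X ^ 3) ^ k * (X ^ 3) ^ k * (X ^ (2 * k) * (X ^ (2 * k)) ^ (2 * k)) * X) := by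
        gcongr
    _ = X ^ (⌈c⌉₊ + 6 * k + 2 * k + 4 * k ^ 2 + 1) := by ring
    _ ≤ X ^ ((⌈c⌉₊ + 13) * k ^ 2) := by
        -- Here `13 = 6 + 2 + 4 + 1`, using `1 ≤ k ≤ k ^ 2`.
        refine pow_le_pow_right₀ hX1 ?_
        have : k ≤ k ^ 2 := Nat.le_self_pow two_ne_zero k
        nlinarith [Nat.zero_le ⌈c⌉₊]

theorem theorem8 (σ : ℝ → ℝ) (hσ : ActivationAssumption σ) :
    ∃ C : ℝ, 0 < C ∧
      ∀ (d k : ℕ) (ε : ℝ), 1 ≤ d → 1 ≤ k → 0 < ε →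
        ∃ (n : ℕ) (w : Fin n → EuclideanSpace ℝ (Fin d)) (v b : Fin n → ℝ) (b₀ : ℝ),
          (n : ℝ) ≤ Real.exp (C * ((k : ℝ) ^ 2 * Real.log ((d : ℝ) / ε))) ∧
          ∀ x ∈ Metric.closedBall (0 : EuclideanSpace ℝ (Fin d)) 1,
            |depthTwoNetwork σ w v b b₀ x - ‖x‖ ^ (2 * k)| ≤ ε := by
  obtain ⟨c, hc, H⟩ := hσ
  refine ⟨⌈c⌉₊ + 13, by positivity, fun d k ε hd hk hε => ?_⟩
  -- For large `ε` the width bound may drop below 1, so no neuron is allowed; the constant `1 / 2`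
  -- suffices.
  rcases le_or_gt (1 / 2) ε with hε' | hε'
  · refine ⟨0, Fin.elim0, Fin.elim0, Fin.elim0, 1 / 2, by simpa using (Real.exp_pos _).le,
      fun x hx => ?_⟩
    have hx1 : ‖x‖ ^ (2 * k) ≤ 1 := pow_le_one₀ (norm_nonneg x) (by simpa using hx)
    have hx0 : 0 ≤ ‖x‖ ^ (2 * k) := by positivity
    simp only [depthTwoNetwork, Finset.univ_eq_empty, Finset.sum_empty, zero_add]
    rw [abs_le]
    constructor <;> linarith
  have hk0 : (0 : ℝ) < k := by exact_mod_cast hk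
  have hd0 : (0 : ℝ) < d := by exact_mod_cast hd
  have hδ : 0 < ε / (4 * d : ℝ) ^ k := by positivity
  have hR : (((2 * k : ℕ) : NNReal) : ℝ) = 2 * k := by push_cast; ring
  obtain ⟨w, a, α, β, γ, hw, happ⟩ := H _ (2 * k) _ _ (by positivity) hδ
    (lipschitzWith_min_abs_pow (2 * k : ℕ) (2 * k)) ⟨(2 * k) ^ (2 * k), fun t ht => by
      have : (2 * k : ℝ) ≤ |t| := by
        by_contra! h
        exact ht (abs_le.1 h.le)
      simp only [hR, min_eq_right this]⟩
  obtain ⟨W, v, b, b₀, hnet⟩ := exists_depthTwoNetwork_of_sum_ridge (σ := σ) a α β γ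
    (fun u : (Fin k → Fin d) × Finset (Fin k × Bool) => (-1) ^ u.2.card / ((2 * k).factorial : ℝ))
    (fun u => ∑ j ∈ u.2ᶜ, EuclideanSpace.single (u.1 j.1) 1)
  have hU : (Fintype.card ((Fin k → Fin d) × Finset (Fin k × Bool)) : ℝ) = (4 * d) ^ k := by
    simp only [Fintype.card_prod, Fintype.card_fun, Fintype.card_fin, Fintype.card_finset,
      Fintype.card_bool]
    push_cast
    rw [mul_comm k 2, pow_mul, mul_pow]
    ring
  refine ⟨_, W, v, b, b₀, ?_, fun x hx => ?_⟩
  · refine le_trans ?_ (width_bound (c := c) (by exact_mod_cast hd) hk hε hε')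
    push_cast [hU]
    push_cast at hw
    gcongr
  · have hx1 : ‖x‖ ≤ 1 := by simpa using hx
    rw [hnet, norm_pow_two_mul_eq_sum_polarization, ← Finset.sum_sub_distrib]
    have hterm (u : (Fin k → Fin d) × Finset (Fin k × Bool)) :
        |(-1) ^ u.2.card / ((2 * k).factorial : ℝ) * (a + ∑ i, α i * σ (β i *
            inner ℝ (∑ j ∈ u.2ᶜ, EuclideanSpace.single (u.1 j.1) (1 : ℝ)) x - γ i))
          - (-1) ^ u.2.card / ((2 * k).factorial : ℝ) * (∑ j ∈ u.2ᶜ, x (u.1 j.1)) ^ (2 * k)|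
        ≤ ε / (4 * d : ℝ) ^ k := by
      have hin : inner ℝ (∑ j ∈ u.2ᶜ, EuclideanSpace.single (u.1 j.1) (1 : ℝ)) x
          = ∑ j ∈ u.2ᶜ, x (u.1 j.1) := by
        simp [sum_inner, EuclideanSpace.inner_single_left]
      have habs : |∑ j ∈ u.2ᶜ, x (u.1 j.1)| ≤ 2 * k :=
        calc _ ≤ ∑ j ∈ u.2ᶜ, |x (u.1 j.1)| := Finset.abs_sum_le_sum_abs _ _
          _ ≤ ∑ j ∈ u.2ᶜ, (1 : ℝ) :=
            Finset.sum_le_sum fun j _ => (PiLp.norm_apply_le x (u.1 j.1)).trans hx1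
          _ ≤ ∑ j : Fin k × Bool, (1 : ℝ) :=
            Finset.sum_le_sum_of_subset_of_nonneg (Finset.subset_univ _) (by simp)
          _ = 2 * k := by simp [mul_comm]
      have h := happ (∑ j ∈ u.2ᶜ, x (u.1 j.1))
      simp only [hR, min_eq_left habs, (even_two_mul k).pow_abs] at h
      rw [hin, ← mul_sub, abs_mul, abs_sub_comm, abs_div, abs_pow, abs_neg, abs_one, one_pow,
        Nat.abs_cast]
      -- Coefficients `±1 / (2k)!` do not amplify the error.
      refine (mul_le_of_le_one_left (abs_nonneg _) ?_).trans h
      exact div_le_one_of_le₀ (by exact_mod_cast (2 * k).factorial_pos) (by positivity)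
    refine (Finset.abs_sum_le_sum_abs _ _).trans ((Finset.sum_le_sum fun u _ => hterm u).trans ?_)
    rw [Finset.sum_const, Finset.card_univ, nsmul_eq_mul, hU]
    exact (mul_div_cancel₀ _ (by positivity)).le
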